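/- A weighted shift $W_\alpha$ with bounded positive weight sequence $\alpha=(\alpha_n)_{n\ge 0}$ is the bounded operator on $\ell^2(\mathbb{Z}_{\ge 0})$ (over $\mathbb{C}$) with $W_\alpha(x_0,x_1,\ldots)=(0,\alpha_0x_0,\alpha_1x_1,\ldots)$. A bounded operator on a complex Hilbert space is subnormal if it is the restriction of a bounded normal operator, on a Hilbert space containing the given one, to that invariant subspace. The shift $W_\alpha$ is moment infinitely divisible (MID) if for every real $t>0$ the weighted shift with weights $\alpha_0^t,\alpha_1^t,\ldots$ is subnormal. If $0<p<1$, then the weighted shift with weights $\alpha_n=(1-p^{2n+2})^{1/2}$, $n=0,1,\ldots$, is subnormal and moment infinitely divisible. Further, if $p_1,\ldots,p_k$ is a finite collection of values in $(0,1)$, then the weighted shift with weights $\alpha_n=\prod_{i=1}^k(1-p_i^{2n+2})^{1/2}$, $n=0,1,\ldots$, is subnormal and moment infinitely divisible. -/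

import Mathlib

/-- A bounded operator `T` on a complex Hilbert space `H` is subnormal if it has a normal extension:
a bounded normal operator `N` on a Hilbert space `K` containing (an isometric copy of) `H`, such
that `N` leaves `H` invariant and restricts to `T` on `H`. -/
def IsSubnormalOperator {H : Type} [NormedAddCommGroup H] [InnerProductSpace ℂ H] [CompleteSpace H]
    (T : H →L[ℂ] H) : Prop :=
  ∃ (K : Type) (_ : NormedAddCommGroup K) (_ : InnerProductSpace ℂ K) (_ : CompleteSpace K)
    (J : H →ₗᵢ[ℂ] K) (N : K →L[ℂ] K),
    IsStarNormal N ∧ ∀ x : H, N (J x) = J (T x)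

/-- Weight sequences of bounded unilateral weighted shifts: bounded sequences of positive reals. -/
structure IsWeightSequence (α : ℕ → ℝ) : Prop where
  pos : ∀ n, 0 < α n
  bddAbove : BddAbove (Set.range α)

/-- The sequence `(0, α₀ x₀, α₁ x₁, …)`. -/
def shiftSeq (α : ℕ → ℝ) (x : ℕ → ℂ) : ℕ → ℂ
  | 0 => 0
  | n + 1 => (α n : ℂ) * x n

theorem shiftSeq_summable_bound {α : ℕ → ℝ} {C : ℝ} (h0 : ∀ n, 0 < α n) (hC : ∀ n, α n ≤ C)
    (x : lp (fun _ : ℕ => ℂ) 2) :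
    Summable (fun n => ‖shiftSeq α x n‖ ^ 2) ∧
      ∑' n, ‖shiftSeq α x n‖ ^ 2 ≤ C ^ 2 * ‖x‖ ^ 2 := by
  have hx : HasSum (fun n => ‖x n‖ ^ 2) (‖x‖ ^ 2) := by
    simpa using lp.hasSum_norm (p := 2) (by norm_num) x
  have hle : ∀ n, ‖shiftSeq α x (n + 1)‖ ^ 2 ≤ C ^ 2 * ‖x n‖ ^ 2 := by
    intro n
    have h1 : ‖shiftSeq α x (n + 1)‖ = α n * ‖x n‖ := by
      simp [shiftSeq, abs_of_pos (h0 n)]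
    rw [h1, mul_pow]
    have := h0 n
    have := hC n
    gcongr
  have hs : Summable (fun n => ‖shiftSeq α x (n + 1)‖ ^ 2) :=
    Summable.of_nonneg_of_le (fun n => by positivity) hle (hx.summable.mul_left _)
  have hs' : Summable (fun n => ‖shiftSeq α x n‖ ^ 2) := (summable_nat_add_iff 1).1 hs
  refine ⟨hs', ?_⟩
  rw [hs'.tsum_eq_zero_add]
  have h2 := hs.tsum_le_tsum hle (hx.summable.mul_left _)
  rw [tsum_mul_left, hx.tsum_eq] at h2
  simpa [shiftSeq] using h2

theorem shiftSeq_memℓp {α : ℕ → ℝ} (hα : IsWeightSequence α) (x : lp (fun _ : ℕ => ℂ) 2) :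
    Memℓp (E := fun _ : ℕ => ℂ) (shiftSeq α x) 2 := by
  obtain ⟨C, hC⟩ := hα.bddAbove
  have h := (shiftSeq_summable_bound hα.pos (fun n => hC ⟨n, rfl⟩) x).1
  exact memℓp_gen (by simpa using h)

/-- The unilateral weighted shift on `ℓ²` with weights `α`: it sends `(x₀, x₁, …)` to
`(0, α₀ x₀, α₁ x₁, …)`. -/
noncomputable def weightedShift (α : ℕ → ℝ) (hα : IsWeightSequence α) :
    lp (fun _ : ℕ => ℂ) 2 →L[ℂ] lp (fun _ : ℕ => ℂ) 2 :=
  LinearMap.mkContinuousOfExistsBound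
    { toFun := fun x => ⟨shiftSeq α x, shiftSeq_memℓp hα x⟩
      map_add' := by
        intro x y
        refine lp.ext (funext fun n => ?_)
        cases n with
        | zero => exact (add_zero (0 : ℂ)).symm
        | succ n => exact mul_add (α n : ℂ) (x n) (y n)
      map_smul' := by
        intro c x
        refine lp.ext (funext fun n => ?_)
        cases n with
        | zero => simp [shiftSeq]
        | succ n => simp [shiftSeq, mul_left_comm] }
    (by
      obtain ⟨C, hC⟩ := hα.bddAbove
      have hC' : ∀ n, α n ≤ C := fun n => hC ⟨n, rfl⟩
      have hC0 : 0 ≤ C := (hα.pos 0).le.trans (hC' 0)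
      refine ⟨C, fun x => ?_⟩
      refine lp.norm_le_of_tsum_le (p := 2) (by norm_num) (by positivity) ?_
      have h := (shiftSeq_summable_bound hα.pos hC' x).2
      simpa [mul_pow] using h)

theorem weightedShift_apply_zero (α : ℕ → ℝ) (hα : IsWeightSequence α)
    (x : lp (fun _ : ℕ => ℂ) 2) : weightedShift α hα x 0 = 0 := rfl

theorem weightedShift_apply_succ (α : ℕ → ℝ) (hα : IsWeightSequence α)
    (x : lp (fun _ : ℕ => ℂ) 2) (n : ℕ) :
    weightedShift α hα x (n + 1) = (α n : ℂ) * x n := rfl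

/-- `α` is the weight sequence of a bounded weighted shift, and that shift is subnormal. -/
def ShiftIsSubnormal (α : ℕ → ℝ) : Prop :=
  ∃ hα : IsWeightSequence α, IsSubnormalOperator (weightedShift α hα)

/-- The weighted shift with weights `α` is moment infinitely divisible: for every real `t > 0` the
weighted shift with weights `α₀ ^ t, α₁ ^ t, …` is subnormal. -/
def ShiftIsMID (α : ℕ → ℝ) : Prop :=
  IsWeightSequence α ∧ ∀ t : ℝ, 0 < t → ShiftIsSubnormal (fun n => α n ^ t)

/-! A weighted shift is subnormal as soon as the products `γ n` of its first `n` squared weights are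
moments of a positive measure on `[0, 1]` (the needed half of Berger's theorem,
`isSubnormalOperator_of_isAtomicMoment`). For the `t`-th powers of the weights and `q = p ^ 2`, one
factor contributes `(q; q)_n ^ t = (q; q)_∞ ^ t * exp (-t * log (q ^ (n + 1); q)_∞)`. Expanding the
logarithm gives a nonnegative combination of sequences `n ↦ (q ^ m) ^ n`. Atomic moment sequences
are closed under products and convergent sums, hence under `exp`, so this factor is one for every `t
> 0`; finitely many factors multiply. -/

/-- `γ` is the moment sequence of a purely atomic positive measure on `[0, 1]`. -/
def IsAtomicMoment (γ : ℕ → ℝ) : Prop :=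
  ∃ (ι : Type) (c x : ι → ℝ), (∀ i, 0 ≤ c i) ∧ (∀ i, 0 ≤ x i) ∧ (∀ i, x i ≤ 1) ∧
    ∀ n, HasSum (fun i => c i * x i ^ n) (γ n)

/-! ### Closure properties of atomic moment sequences. -/

namespace IsAtomicMoment

theorem geometric {x : ℝ} (h0 : 0 ≤ x) (h1 : x ≤ 1) : IsAtomicMoment (fun n => x ^ n) :=
  ⟨Unit, fun _ => 1, fun _ => x, by simp, fun _ => h0, fun _ => h1, fun n => by simp⟩

theorem one : IsAtomicMoment (fun _ => 1) := by
  simpa using geometric zero_le_one le_rfl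

theorem const_mul {γ : ℕ → ℝ} (h : IsAtomicMoment γ) {a : ℝ} (ha : 0 ≤ a) :
    IsAtomicMoment (fun n => a * γ n) := by
  obtain ⟨ι, c, x, hc, h0, h1, hs⟩ := h
  refine ⟨ι, fun i => a * c i, x, fun i => mul_nonneg ha (hc i), h0, h1, fun n => ?_⟩
  simpa [mul_assoc] using (hs n).mul_left a

/-- Multiplicative convolution of the measures: atoms multiply, and so do their masses. -/
theorem mul {γ δ : ℕ → ℝ} (hγ : IsAtomicMoment γ) (hδ : IsAtomicMoment δ) :
    IsAtomicMoment (fun n => γ n * δ n) := by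
  obtain ⟨ι, c, x, hc, h0, h1, hs⟩ := hγ
  obtain ⟨κ, d, y, hd, k0, k1, ks⟩ := hδ
  refine ⟨ι × κ, fun i => c i.1 * d i.2, fun i => x i.1 * y i.2,
    fun i => mul_nonneg (hc _) (hd _), fun i => mul_nonneg (h0 _) (k0 _),
    fun i => mul_le_one₀ (h1 _) (k0 _) (k1 _), fun n => ?_⟩
  have hsum := (hs n).summable.mul_of_nonneg (ks n).summable
    (fun i => mul_nonneg (hc i) (pow_nonneg (h0 i) n))
    (fun i => mul_nonneg (hd i) (pow_nonneg (k0 i) n))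
  have := (hs n).mul (ks n) hsum
  simpa [mul_pow, mul_mul_mul_comm] using this

theorem pow {γ : ℕ → ℝ} (h : IsAtomicMoment γ) (N : ℕ) : IsAtomicMoment (fun n => γ n ^ N) := by
  induction N with
  | zero => simpa using one
  | succ N ih => simpa [pow_succ] using ih.mul h

theorem prod {σ : Type*} (s : Finset σ) {f : σ → ℕ → ℝ} (h : ∀ j ∈ s, IsAtomicMoment (f j)) :
    IsAtomicMoment (fun n => ∏ j ∈ s, f j n) := by
  classical
  induction s using Finset.induction_on with
  | empty => simpa using one
  | insert a s ha ih =>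
    simp only [Finset.prod_insert ha]
    exact (h a (Finset.mem_insert_self a s)).mul
      (ih fun j hj => h j (Finset.mem_insert_of_mem hj))

theorem of_hasSum {f : ℕ → ℕ → ℝ} {g : ℕ → ℝ} (hf : ∀ N, IsAtomicMoment (f N))
    (hg : ∀ n, HasSum (fun N => f N n) (g n)) : IsAtomicMoment g := by
  choose ι c x hc h0 h1 hs using hf
  refine ⟨Σ N, ι N, fun i => c i.1 i.2, fun i => x i.1 i.2, fun i => hc _ _, fun i => h0 _ _,
    fun i => h1 _ _, fun n => ?_⟩
  have hsum : Summable (fun i : Σ N, ι N => c i.1 i.2 * x i.1 i.2 ^ n) := by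
    refine (summable_sigma_of_nonneg
      fun i => mul_nonneg (hc _ _) (pow_nonneg (h0 _ _) n)).2 ⟨fun N => (hs N n).summable, ?_⟩
    simpa only [(hs _ n).tsum_eq] using (hg n).summable
  exact HasSum.sigma_of_hasSum (hg n) (fun N => hs N n) hsum

theorem exp {γ : ℕ → ℝ} (h : IsAtomicMoment γ) : IsAtomicMoment (fun n => Real.exp (γ n)) := by
  refine of_hasSum (f := fun N n => ((N.factorial : ℝ))⁻¹ * γ n ^ N)
    (fun N => (h.pow N).const_mul (by positivity)) fun n => ?_
  rw [Real.exp_eq_exp_ℝ]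
  simpa [div_eq_inv_mul] using NormedSpace.expSeries_div_hasSum_exp (γ n)

theorem neg_log_one_sub {a q : ℝ} (ha0 : 0 ≤ a) (ha1 : a < 1) (hq0 : 0 ≤ q) (hq1 : q ≤ 1) :
    IsAtomicMoment (fun n => -Real.log (1 - a * q ^ n)) := by
  refine of_hasSum (f := fun m n => a ^ (m + 1) / (m + 1) * (q ^ (m + 1)) ^ n)
    (fun m => (geometric (by positivity) (pow_le_one₀ hq0 hq1)).const_mul (by positivity))
    fun n => ?_
  have hlt : |a * q ^ n| < 1 := by
    rw [abs_of_nonneg (by positivity)]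
    exact (mul_le_of_le_one_right ha0 (pow_le_one₀ hq0 hq1)).trans_lt ha1
  convert! Real.hasSum_pow_div_log_of_abs_lt_one hlt using 2 with m
  rw [mul_pow, ← pow_mul, ← pow_mul, mul_comm n]
  ring

/-- The finite product is a quotient of infinite ones, and the tail in the denominator has
logarithmic series with nonnegative coefficients. -/
theorem qPochhammer_rpow {q : ℝ} (hq0 : 0 < q) (hq1 : q < 1) {t : ℝ} (ht : 0 < t) :
    IsAtomicMoment (fun n => ∏ j ∈ Finset.range n, (1 - q ^ (j + 1)) ^ t) := by
  set l : ℕ → ℝ := fun j => -Real.log (1 - q ^ (j + 1)) with hl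
  have hpos : ∀ j : ℕ, 0 < 1 - q ^ (j + 1) := fun j =>
    sub_pos.2 (pow_lt_one₀ hq0.le hq1 (Nat.succ_ne_zero j))
  have hsum : Summable l := by
    have h : Summable (fun j : ℕ => -q ^ (j + 1)) :=
      ((summable_nat_add_iff 1).2 (summable_geometric_of_lt_one hq0.le hq1)).neg
    simpa [hl, sub_eq_add_neg] using (Real.summable_log_one_add_of_summable h).neg
  have hS : IsAtomicMoment (fun n => ∑' j, l (j + n)) := by
    refine of_hasSum (f := fun j n => l (j + n)) (fun j => ?_)
      fun n => ((summable_nat_add_iff n).2 hsum).hasSum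
    have := neg_log_one_sub (a := q ^ (j + 1)) (by positivity)
      (pow_lt_one₀ hq0.le hq1 (Nat.succ_ne_zero j)) hq0.le hq1.le
    convert! this using 5 with n
    ring
  -- The constant is `(q; q)_∞ ^ t`; the exponential is the inverse `t`-th power of the tail from
  -- index `n`.
  have h := ((hS.const_mul ht.le).exp).const_mul (Real.exp_pos (-(t * ∑' j, l j))).le
  convert! h using 2 with n
  rw [← Real.exp_add, ← hsum.sum_add_tsum_nat_add n]
  have : -(t * (∑ j ∈ Finset.range n, l j + ∑' j, l (j + n))) + t * ∑' j, l (j + n)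
      = ∑ j ∈ Finset.range n, Real.log (1 - q ^ (j + 1)) * t := by
    simp only [hl, ← Finset.sum_mul, Finset.sum_neg_distrib]
    ring
  rw [this, Real.exp_sum]
  exact Finset.prod_congr rfl fun j _ => Real.rpow_def_of_pos (hpos j) t

end IsAtomicMoment

/-! ### Normal weighted composition operators. -/

section WeightedComposition

variable {κ : Type}

theorem summable_weightedComp (e : κ ≃ κ) {w : κ → ℝ} (hw : ∀ k, |w k| ≤ 1)
    (f : lp (fun _ : κ => ℂ) 2) :
    Summable (fun k => ‖(w k : ℂ) * f (e k)‖ ^ 2) ∧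
      ∑' k, ‖(w k : ℂ) * f (e k)‖ ^ 2 ≤ ‖f‖ ^ 2 := by
  have hf : HasSum (fun k => ‖f k‖ ^ 2) (‖f‖ ^ 2) := by
    simpa using lp.hasSum_norm (p := 2) (by norm_num) f
  have hfe : HasSum (fun k => ‖f (e k)‖ ^ 2) (‖f‖ ^ 2) := e.hasSum_iff.2 hf
  have hle : ∀ k, ‖(w k : ℂ) * f (e k)‖ ^ 2 ≤ ‖f (e k)‖ ^ 2 := fun k => by
    rw [norm_mul, Complex.norm_real, Real.norm_eq_abs]
    gcongr
    exact mul_le_of_le_one_left (norm_nonneg _) (hw k)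
  have hs := Summable.of_nonneg_of_le (fun k => by positivity) hle hfe.summable
  exact ⟨hs, (hs.tsum_le_tsum hle hfe.summable).trans_eq hfe.tsum_eq⟩

/-- The weighted composition operator `f ↦ w · (f ∘ e)` on `ℓ²(κ)`. -/
noncomputable def weightedComp (e : κ ≃ κ) (w : κ → ℝ) (hw : ∀ k, |w k| ≤ 1) :
    lp (fun _ : κ => ℂ) 2 →L[ℂ] lp (fun _ : κ => ℂ) 2 :=
  LinearMap.mkContinuous
    { toFun := fun f => ⟨fun k => (w k : ℂ) * f (e k),
        memℓp_gen (by simpa using (summable_weightedComp e hw f).1)⟩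
      map_add' := fun f g => lp.ext (funext fun k => mul_add (w k : ℂ) (f (e k)) (g (e k)))
      map_smul' := fun c f => lp.ext (funext fun k => mul_left_comm (w k : ℂ) c (f (e k))) }
    1 (fun f => by
      refine lp.norm_le_of_tsum_le (p := 2) (by norm_num) (by positivity) ?_
      simpa using (summable_weightedComp e hw f).2)

theorem weightedComp_apply (e : κ ≃ κ) (w : κ → ℝ) (hw : ∀ k, |w k| ≤ 1)
    (f : lp (fun _ : κ => ℂ) 2) (k : κ) : weightedComp e w hw f k = (w k : ℂ) * f (e k) := rfl

theorem adjoint_weightedComp (e : κ ≃ κ) (w : κ → ℝ) (hw : ∀ k, |w k| ≤ 1)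
    (hwe : ∀ k, w (e k) = w k) :
    ContinuousLinearMap.adjoint (weightedComp e w hw) = weightedComp e.symm w hw := by
  refine ((ContinuousLinearMap.eq_adjoint_iff _ _).2 fun f g => ?_).symm
  rw [lp.inner_eq_tsum, lp.inner_eq_tsum, ← e.tsum_eq]
  refine tsum_congr fun k => ?_
  simp only [weightedComp_apply, RCLike.inner_apply, map_mul, Complex.conj_ofReal,
    Equiv.symm_apply_apply, hwe]
  ring

/-- Since `w` is constant on orbits of `e`, both products with the adjoint are multiplication by `w
^ 2`. -/
theorem isStarNormal_weightedComp (e : κ ≃ κ) (w : κ → ℝ) (hw : ∀ k, |w k| ≤ 1)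
    (hwe : ∀ k, w (e k) = w k) : IsStarNormal (weightedComp e w hw) := by
  refine ⟨?_⟩
  rw [ContinuousLinearMap.star_eq_adjoint, adjoint_weightedComp e w hw hwe]
  have hwe' : ∀ k, w (e.symm k) = w k := fun k => by rw [← hwe, e.apply_symm_apply]
  refine ContinuousLinearMap.ext fun f => lp.ext (funext fun k => ?_)
  simp only [mul_apply_eq_comp, weightedComp_apply, Equiv.symm_apply_apply,
    Equiv.apply_symm_apply, hwe, hwe']

end WeightedComposition

/-! ### Normal extensions of weighted shifts. -/

theorem isSubnormalOperator_of_orthonormal {K : Type} [NormedAddCommGroup K]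
    [InnerProductSpace ℂ K] [CompleteSpace K] {N : K →L[ℂ] K} (hN : IsStarNormal N)
    {v : ℕ → K} (hv : Orthonormal ℂ v) {α : ℕ → ℝ} (hα : IsWeightSequence α)
    (hNv : ∀ n, N (v n) = (α n : ℂ) • v (n + 1)) :
    IsSubnormalOperator (weightedShift α hα) := by
  refine ⟨K, _, _, inferInstance, hv.orthogonalFamily.linearIsometry, N, hN, fun x => ?_⟩
  have h1 := (hv.orthogonalFamily.hasSum_linearIsometry x).mapL N
  have h2 := hv.orthogonalFamily.hasSum_linearIsometry (weightedShift α hα x)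
  -- The zeroth coordinate of the shifted vector vanishes, so dropping it aligns the two series.
  rw [← hasSum_nat_add_iff' 1] at h2
  simp only [Finset.range_one, Finset.sum_singleton, weightedShift_apply_zero, map_zero,
    sub_zero] at h2
  refine h1.unique ?_
  convert! h2 using 2 with n
  simp only [LinearIsometry.toSpanSingleton_apply, map_smul, hNv, weightedShift_apply_succ,
    smul_smul, mul_comm]

/-- The `n`-th basis vector of the copy of `ℓ²(ℕ)` inside `ℓ²(ι × ℤ)`, before it is put in `ℓ²`. -/
noncomputable def momentVectorFun {ι : Type} (c x : ι → ℝ) (γ : ℕ → ℝ) (n : ℕ) (i : ι × ℤ) : ℂ :=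
  if i.2 = n then ((√(c i.1) * √(x i.1) ^ n / √(γ n) : ℝ) : ℂ) else 0

theorem hasSum_normSq_momentVectorFun {ι : Type} {c x : ι → ℝ} {γ : ℕ → ℝ} (hc : ∀ i, 0 ≤ c i)
    (hx : ∀ i, 0 ≤ x i) (hγ : ∀ n, 0 < γ n) {n : ℕ}
    (hs : HasSum (fun i => c i * x i ^ n) (γ n)) :
    HasSum (fun i => ‖momentVectorFun c x γ n i‖ ^ 2) 1 := by
  have hinj : Function.Injective (fun i : ι => (i, (n : ℤ))) := fun i j h => (Prod.ext_iff.1 h).1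
  rw [← hinj.hasSum_iff]
  · have h := hs.div_const (γ n)
    rw [div_self (hγ n).ne'] at h
    convert! h using 2 with i
    simp only [Function.comp_apply, momentVectorFun, if_true, Complex.norm_real, Real.norm_eq_abs,
      sq_abs, div_pow, mul_pow]
    rw [← pow_mul, mul_comm n 2, pow_mul, Real.sq_sqrt (hc i), Real.sq_sqrt (hx i),
      Real.sq_sqrt (hγ n).le]
  · rintro ⟨i, k⟩ hk
    have : k ≠ n := fun h => hk ⟨i, by rw [h]⟩
    simp [momentVectorFun, this]

theorem isSubnormalOperator_of_isAtomicMoment {α : ℕ → ℝ} {γ : ℕ → ℝ} (hα : IsWeightSequence α)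
    (hγ : IsAtomicMoment γ) (hpos : ∀ n, 0 < γ n) (hrec : ∀ n, γ (n + 1) = α n ^ 2 * γ n) :
    IsSubnormalOperator (weightedShift α hα) := by
  obtain ⟨ι, c, x, hc, h0, h1, hs⟩ := hγ
  have hnorm := fun n => hasSum_normSq_momentVectorFun hc h0 hpos (hs n)
  let v : ℕ → lp (fun _ : ι × ℤ => ℂ) 2 := fun n =>
    ⟨momentVectorFun c x γ n, memℓp_gen (by simpa using (hnorm n).summable)⟩
  have hvapp : ∀ n i, v n i = momentVectorFun c x γ n i := fun _ _ => rfl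
  have hv : Orthonormal ℂ v := by
    refine ⟨fun n => ?_, fun m n hmn => ?_⟩
    · have h := lp.hasSum_norm (p := 2) (by norm_num) (v n)
      have h' := h.unique (by simpa [hvapp] using hnorm n)
      rw [ENNReal.toReal_ofNat, Real.rpow_ofNat] at h'
      exact (pow_eq_one_iff_of_nonneg (norm_nonneg _) two_ne_zero).1 h'
    · change inner ℂ (v m) (v n) = 0
      rw [lp.inner_eq_tsum]
      refine (tsum_congr fun i => ?_).trans tsum_zero
      rw [hvapp, hvapp, RCLike.inner_apply]
      by_cases hi : i.2 = n
      · have : i.2 ≠ m := fun h => hmn (by exact_mod_cast h.symm.trans hi)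
        simp [momentVectorFun, this]
      · simp [momentVectorFun, hi]
  have hw : ∀ i : ι × ℤ, |√(x i.1)| ≤ 1 := fun i => by
    rw [abs_of_nonneg (Real.sqrt_nonneg _)]
    exact Real.sqrt_le_one.2 (h1 _)
  -- On the fibre `{i} × ℤ` the normal operator is the bilateral shift scaled by `√(x i)`.
  refine isSubnormalOperator_of_orthonormal
    (isStarNormal_weightedComp (Equiv.prodCongr (Equiv.refl ι) (Equiv.subRight 1))
      (fun i => √(x i.1)) hw fun _ => rfl) hv hα fun n => lp.ext (funext fun i => ?_)
  change (√(x i.1) : ℂ) * momentVectorFun c x γ n (i.1, i.2 - 1)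
    = (α n : ℂ) * momentVectorFun c x γ (n + 1) i
  have hiff : i.2 - 1 = (n : ℤ) ↔ i.2 = ((n + 1 : ℕ) : ℤ) := by push_cast; omega
  simp only [momentVectorFun, hiff]
  split_ifs
  · rw [← Complex.ofReal_mul, ← Complex.ofReal_mul, hrec, Real.sqrt_mul (sq_nonneg _),
      Real.sqrt_sq (hα.pos n).le]
    have := (hα.pos n).ne'
    have := (Real.sqrt_pos.2 (hpos n)).ne'
    congr 1
    field_simp
    ring
  · simp

theorem isWeightSequence_of_le_one {α : ℕ → ℝ} (h0 : ∀ n, 0 < α n) (h1 : ∀ n, α n ≤ 1) :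
    IsWeightSequence α :=
  ⟨h0, 1, by rintro _ ⟨n, rfl⟩; exact h1 n⟩

theorem one_sub_pow_mem {p : ℝ} (h0 : 0 < p) (h1 : p < 1) (n : ℕ) :
    0 < 1 - p ^ (2 * n + 2) ∧ 1 - p ^ (2 * n + 2) ≤ 1 :=
  ⟨sub_pos.2 (pow_lt_one₀ h0.le h1 (by omega)), sub_le_self _ (by positivity)⟩

theorem isWeightSequence_prod {k : ℕ} {p : Fin k → ℝ} (hp : ∀ i, 0 < p i ∧ p i < 1) :
    IsWeightSequence (fun n => ∏ i, (1 - p i ^ (2 * n + 2)) ^ ((1 : ℝ) / 2)) := by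
  have h := fun i n => one_sub_pow_mem (hp i).1 (hp i).2 n
  exact isWeightSequence_of_le_one
    (fun n => Finset.prod_pos fun i _ => Real.rpow_pos_of_pos (h i n).1 _)
    fun n => Finset.prod_le_one (fun i _ => (Real.rpow_pos_of_pos (h i n).1 _).le)
      fun i _ => Real.rpow_le_one (h i n).1.le (h i n).2 (by norm_num)

theorem IsWeightSequence.rpow {α : ℕ → ℝ} (hα : IsWeightSequence α) {t : ℝ} (ht : 0 < t) :
    IsWeightSequence (fun n => α n ^ t) := by
  obtain ⟨C, hC⟩ := hα.bddAbove
  refine ⟨fun n => Real.rpow_pos_of_pos (hα.pos n) t, C ^ t, ?_⟩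
  rintro _ ⟨n, rfl⟩
  exact Real.rpow_le_rpow (hα.pos n).le (hC ⟨n, rfl⟩) ht.le

theorem ShiftIsMID.shiftIsSubnormal {α : ℕ → ℝ} (h : ShiftIsMID α) : ShiftIsSubnormal α := by
  simpa using h.2 1 one_pos

theorem shiftIsMID_prod {k : ℕ} {p : Fin k → ℝ} (hp : ∀ i, 0 < p i ∧ p i < 1) :
    ShiftIsMID (fun n => ∏ i, (1 - p i ^ (2 * n + 2)) ^ ((1 : ℝ) / 2)) := by
  have h := fun i n => one_sub_pow_mem (hp i).1 (hp i).2 n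
  have hα := isWeightSequence_prod hp
  refine ⟨hα, fun t ht => ⟨hα.rpow ht, ?_⟩⟩
  -- Squaring the weights cancels their exponent `1 / 2`, leaving exponent `t`.
  refine isSubnormalOperator_of_isAtomicMoment
    (γ := fun n => ∏ i, ∏ j ∈ Finset.range n, (1 - (p i ^ 2) ^ (j + 1)) ^ t) (hα.rpow ht)
    (IsAtomicMoment.prod _ fun i _ => IsAtomicMoment.qPochhammer_rpow (pow_pos (hp i).1 2)
      (pow_lt_one₀ (hp i).1.le (hp i).2 two_ne_zero) ht) (fun n => ?_) fun n => ?_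
  · refine Finset.prod_pos fun i _ => Finset.prod_pos fun j _ => Real.rpow_pos_of_pos ?_ t
    simpa [← pow_mul, mul_add] using (h i j).1
  · simp only [Finset.prod_range_succ, Finset.prod_mul_distrib]
    rw [mul_comm]
    congr 1
    rw [← Real.finsetProd_rpow _ _ fun i _ => (Real.rpow_pos_of_pos (h i n).1 _).le,
      ← Finset.prod_pow]
    refine Finset.prod_congr rfl fun i _ => ?_
    rw [← Real.rpow_mul (h i n).1.le, ← Real.rpow_mul_natCast (h i n).1.le, ← pow_mul]
    congr 1
    push_cast
    ring

theorem corollary3p4 :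
    (∀ p : ℝ, 0 < p → p < 1 →
      ShiftIsSubnormal (fun n => (1 - p ^ (2 * n + 2)) ^ ((1 : ℝ) / 2)) ∧
      ShiftIsMID (fun n => (1 - p ^ (2 * n + 2)) ^ ((1 : ℝ) / 2))) ∧
    (∀ (k : ℕ) (p : Fin k → ℝ), (∀ i, 0 < p i ∧ p i < 1) →
      ShiftIsSubnormal (fun n => ∏ i, (1 - p i ^ (2 * n + 2)) ^ ((1 : ℝ) / 2)) ∧
      ShiftIsMID (fun n => ∏ i, (1 - p i ^ (2 * n + 2)) ^ ((1 : ℝ) / 2))) := by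
  refine ⟨fun p h0 h1 => ?_, fun k p hp => ⟨(shiftIsMID_prod hp).shiftIsSubnormal,
    shiftIsMID_prod hp⟩⟩
  have h : ShiftIsMID (fun n => (1 - p ^ (2 * n + 2)) ^ ((1 : ℝ) / 2)) := by
    simpa only [Fin.prod_univ_one] using shiftIsMID_prod (p := fun _ : Fin 1 => p) fun _ => ⟨h0, h1⟩
  exact ⟨h.shiftIsSubnormal, h⟩
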